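/- Let $k$ be a commutative ring and let $R$ be a unital associative (not necessarily commutative) $k$-algebra that is free as a $k$-module. Let $\mathfrak{sl}_4(R)$ be the $k$-Lie subalgebra of $\mathfrak{gl}_4(R)$ generated by the matrices $sE_{ij}$ with $s\in R$ and $1\le i\ne j\le 4$. A central extension of a $k$-Lie algebra $\mathfrak{g}$ is a surjective homomorphism $f:M\to\mathfrak{g}$ of $k$-Lie algebras whose kernel lies in the centre of $M$; a central extension $u:L\to\mathfrak{g}$ is universal if for every central extension $f:M\to\mathfrak{g}$ there is exactly one homomorphism $\varphi:L\to M$ with $f\circ\varphi=u$. Let $\mathfrak{p}$ be the $k$-Lie algebra presented by the generators $X_{ij}(s)$ ($s\in R$, $1\le i\neq j\le 4$) subject to the following relations, for all $a,b\in R$ and all indices in $\{1,2,3,4\}$: 1. $a\mapsto X_{ij}(a)$ is $k$-linear, for all $i\ne j$; 2. $[X_{ij}(a),X_{jk}(b)]=X_{ik}(ab)$ for distinct $i,j,k$; 3. $[X_{ij}(a),X_{ij}(b)]=0$, $[X_{ij}(a),X_{il}(b)]=0$ and $[X_{ji}(a),X_{li}(b)]=0$ for $j\neq i\neq l$; 4.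 $[w,[X_{ij}(a),X_{kl}(b)]]=0$ for $i,j,k,l$ mutually distinct and every generator $w$. Then the assignment $X_{ij}(s)\mapsto sE_{ij}$ defines a homomorphism $\pi:\mathfrak{p}\to\mathfrak{sl}_4(R)$, and $\pi$ is a universal central extension of $\mathfrak{sl}_4(R)$. Consequently, for every universal central extension $u:L\to\mathfrak{sl}_4(R)$ there is an isomorphism $e:\mathfrak{p}\to L$ of $k$-Lie algebras with $u\circ e=\pi$; that is, the universal central extension $\widehat{\mathfrak{sl}_4(R)}$ has the above presentation. -/

import Mathlib

attribute [local instance 100] LieRing.ofAssociativeRing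

universe uk uR w

section CentralExtensions

variable {k : Type*} [CommRing k]

/-- A central extension of the Lie algebra `g`: a surjective homomorphism of Lie algebras
`f : L → g` whose kernel is contained in the centre of `L`. -/
structure IsCentralExtension {L g : Type*} [LieRing L] [LieAlgebra k L] [LieRing g]
    [LieAlgebra k g] (f : L →ₗ⁅k⁆ g) : Prop where
  surjective : Function.Surjective f
  ker_le_center : f.ker ≤ LieAlgebra.center k L

/-- A universal central extension of `g`: a central extension `u : L → g` such that for every
central extension `f : M → g` (with `M` in the universe `w`) there is exactly one homomorphism
`φ : L → M` with `f ∘ φ = u`. -/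
structure IsUniversalCentralExtension {L g : Type*} [LieRing L] [LieAlgebra k L] [LieRing g]
    [LieAlgebra k g] (u : L →ₗ⁅k⁆ g) : Prop where
  isCentralExtension : IsCentralExtension u
  existsUnique_lift : ∀ (M : Type w) [LieRing M] [LieAlgebra k M] (f : M →ₗ⁅k⁆ g),
    IsCentralExtension f → ∃! φ : L →ₗ⁅k⁆ M, f.comp φ = u

end CentralExtensions

/-- The Lie algebra `sl_n(R)` over `k`, for a possibly noncommutative `k`-algebra `R`: the Lie
subalgebra of `gl_n(R)` generated by the matrices `s E_ij` with `i ≠ j` and `s ∈ R`. -/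
def slLie (n : ℕ) (k : Type uk) (R : Type uR) [CommRing k] [Ring R] [Algebra k R] :
    LieSubalgebra k (Matrix (Fin n) (Fin n) R) :=
  LieSubalgebra.lieSpan k _ {A | ∃ (i j : Fin n) (s : R), i ≠ j ∧ A = Matrix.single i j s}

/-- The index set of the generators `X_ij(s)`, where `1 ≤ i ≠ j ≤ 4` and `s ∈ R`. -/
structure SlFourGen (R : Type uR) where
  row : Fin 4
  col : Fin 4
  row_ne_col : row ≠ col
  coeff : R

section Presentation

variable (k : Type uk) (R : Type uR) [CommRing k] [Ring R] [Algebra k R]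

/-- The free generator `X_ij(s)` of the free Lie algebra. -/
noncomputable def freeX {R : Type uR} (i j : Fin 4) (h : i ≠ j) (s : R) : FreeLieAlgebra k (SlFourGen R) :=
  FreeLieAlgebra.of k ⟨i, j, h, s⟩

/-- The defining relations; `SlFourRel k R x y` is the relation `x = y`. -/
inductive SlFourRel :
    FreeLieAlgebra k (SlFourGen R) → FreeLieAlgebra k (SlFourGen R) → Prop
  | add (i j : Fin 4) (hij : i ≠ j) (a b : R) :
      SlFourRel (freeX k i j hij (a + b)) (freeX k i j hij a + freeX k i j hij b)
  | smul (i j : Fin 4) (hij : i ≠ j) (c : k) (a : R) :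
      SlFourRel (freeX k i j hij (c • a)) (c • freeX k i j hij a)
  | steinberg (i j l : Fin 4) (hij : i ≠ j) (hjl : j ≠ l) (hil : i ≠ l) (a b : R) :
      SlFourRel ⁅freeX k i j hij a, freeX k j l hjl b⁆ (freeX k i l hil (a * b))
  | same (i j : Fin 4) (hij : i ≠ j) (a b : R) :
      SlFourRel ⁅freeX k i j hij a, freeX k i j hij b⁆ 0
  | same_row (i j l : Fin 4) (hij : i ≠ j) (hil : i ≠ l) (a b : R) :
      SlFourRel ⁅freeX k i j hij a, freeX k i l hil b⁆ 0
  | same_col (i j l : Fin 4) (hji : j ≠ i) (hli : l ≠ i) (a b : R) :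
      SlFourRel ⁅freeX k j i hji a, freeX k l i hli b⁆ 0
  | central (i j l m : Fin 4) (hij : i ≠ j) (hlm : l ≠ m) (hil : i ≠ l) (him : i ≠ m)
      (hjl : j ≠ l) (hjm : j ≠ m) (a b : R) (p q : Fin 4) (hpq : p ≠ q) (s : R) :
      SlFourRel ⁅freeX k p q hpq s, ⁅freeX k i j hij a, freeX k l m hlm b⁆⁆ 0

/-- The Lie ideal of the free Lie algebra generated by the relators `x - y`. -/
noncomputable def slFourRelIdeal : LieIdeal k (FreeLieAlgebra k (SlFourGen R)) :=
  LieSubmodule.lieSpan k _ {z | ∃ x y, SlFourRel k R x y ∧ z = x - y}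

/-- The `k`-Lie algebra presented by the generators `X_ij(s)` and the relations `SlFourRel`. -/
abbrev SlFourPres : Type (max uk uR) :=
  FreeLieAlgebra k (SlFourGen R) ⧸ slFourRelIdeal k R

/-- The generator `X_ij(s)` of the presented Lie algebra. -/
noncomputable def presX {R : Type uR} [Ring R] [Algebra k R] (i j : Fin 4) (h : i ≠ j) (s : R) :
    SlFourPres k R :=
  LieSubmodule.Quotient.mk' (slFourRelIdeal k R) (freeX k i j h s)

end Presentation

/-!
Write `𝔭` for the presented Lie algebra and `π : 𝔭 → sl_4(R)` for the map `X_ij(s) ↦ s E_ij`.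

**The kernel of `π` is central.** Let `T ⊆ 𝔭` (`presTorus`) consist of the elements `h` with
`[h, X_ij(R)] ⊆ X_ij(R)` for all `i ≠ j`. It contains the brackets `[X_ij(a), X_ji(b)]`, by the
Jacobi identity, and the central brackets `[X_ij(a), X_lm(b)]` with distinct indices. Hence
`T + ∑ X_ij(R)` is stable under bracketing with the generators, so it is all of `𝔭`. The image of
`T` consists of diagonal matrices, so an element `z` of the kernel has no component in any
`X_ij(R)`, that is, `z ∈ T`; then `[z, X_ij(a)] = X_ij(b)` with `b E_ij = [π z, a E_ij] = 0`.
See `sub_offDiagLift_mem_presTorus` and `isCentralExtension_of_presX`.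

**Universality.** Let `f : M → sl_4(R)` be a central extension. Brackets in `M` depend only on the
images of their arguments under `f`. The Jacobi identity, together with the existence of an index
outside any three given ones, shows that the bracket of lifts of `a E_ij` and `b E_jl` depends only
on `i`, `l` and `a b` (`IsCentralExtension.lie_eq`). These brackets are lifts of the `E_il(ab)` that
satisfy the defining relations of `𝔭`, which gives a homomorphism `𝔭 → M` over `sl_4(R)`. It is
unique because `𝔭` is perfect. As only brackets of lifts are used, no linear section of `f` is
needed.

The comparison with another universal central extension is the usual uniqueness argument.
-/

/-! ### Brackets in central extensions -/

section CentralExtensionLemmas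

variable {k : Type*} [CommRing k] {M g : Type*} [LieRing M] [LieAlgebra k M] [LieRing g]
  [LieAlgebra k g] {f : M →ₗ⁅k⁆ g}

theorem IsCentralExtension.lie_eq_zero (hf : IsCentralExtension f) {u : M} (hu : f u = 0)
    (v : M) : ⁅v, u⁆ = 0 :=
  (LieModule.mem_maxTrivSubmodule k M M u).1
    (hf.ker_le_center (f.mem_ker.2 hu)) v

theorem IsCentralExtension.lie_eq_zero' (hf : IsCentralExtension f) {u : M} (hu : f u = 0)
    (v : M) : ⁅u, v⁆ = 0 := by
  rw [← lie_skew, hf.lie_eq_zero hu, neg_zero]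

/-- In a central extension, a bracket depends only on the images of its two arguments. -/
theorem IsCentralExtension.lie_congr (hf : IsCentralExtension f) {u u' v v' : M}
    (hu : f u = f u') (hv : f v = f v') : ⁅u, v⁆ = ⁅u', v'⁆ := by
  have h1 : ⁅u - u', v⁆ = 0 := hf.lie_eq_zero' (by rw [map_sub, hu, sub_self]) v
  have h2 : ⁅u', v - v'⁆ = 0 := hf.lie_eq_zero (by rw [map_sub, hv, sub_self]) u'
  rw [sub_lie, sub_eq_zero] at h1
  rw [lie_sub, sub_eq_zero] at h2
  rw [h1, h2]

end CentralExtensionLemmas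

/-! ### Lie algebras in a larger universe -/

section ULiftLie

variable {k : Type*} [CommRing k] {L : Type*} [LieRing L] [LieAlgebra k L]

/-- The Lie ring structure on the lift of `L` to a larger universe. -/
instance ULift.instLieRing : LieRing (ULift L) where
  bracket x y := ⟨⁅x.down, y.down⁆⟩
  add_lie _ _ _ := ULift.ext _ _ (add_lie _ _ _)
  lie_add _ _ _ := ULift.ext _ _ (lie_add _ _ _)
  lie_self _ := ULift.ext _ _ (lie_self _)
  leibniz_lie _ _ _ := ULift.ext _ _ (leibniz_lie _ _ _)

instance ULift.instLieAlgebra : LieAlgebra k (ULift L) where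
  lie_smul _ _ _ := ULift.ext _ _ (lie_smul _ _ _)

variable (k L) in
/-- The projection `ULift L → L` as a homomorphism of Lie algebras. -/
def ULift.downLieHom : ULift L →ₗ⁅k⁆ L :=
  { (ULift.moduleEquiv : ULift L ≃ₗ[k] L).toLinearMap with
    map_lie' := fun {_ _} => rfl }

theorem IsCentralExtension.comp_down {g : Type*} [LieRing g] [LieAlgebra k g] {f : L →ₗ⁅k⁆ g}
    (hf : IsCentralExtension f) : IsCentralExtension (f.comp (ULift.downLieHom k L)) where
  surjective x := by
    obtain ⟨y, rfl⟩ := hf.surjective x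
    exact ⟨⟨y⟩, rfl⟩
  ker_le_center x hx := by
    rw [LieModule.mem_maxTrivSubmodule]
    exact fun y => ULift.ext _ _ (hf.lie_eq_zero (u := x.down) hx y.down)

end ULiftLie

/-! ### Elementary matrices in `sl_n(R)` -/

section ElementaryMatrices

variable (k : Type uk) {R : Type uR} [CommRing k] [Ring R] [Algebra k R] {n : ℕ}

/-- The matrix `s E_ij`, `i ≠ j`, as an element of `sl_n(R)`. -/
def slElem (i j : Fin n) (h : i ≠ j) (s : R) : slLie n k R :=
  ⟨Matrix.single i j s, LieSubalgebra.subset_lieSpan ⟨i, j, s, h, rfl⟩⟩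

variable {k}

theorem coe_slElem (i j : Fin n) (h : i ≠ j) (s : R) :
    (slElem k i j h s : Matrix (Fin n) (Fin n) R) = Matrix.single i j s := rfl

theorem slElem_add (i j : Fin n) (h : i ≠ j) (a b : R) :
    slElem k i j h (a + b) = slElem k i j h a + slElem k i j h b :=
  Subtype.ext (Matrix.single_add i j a b)

theorem slElem_smul (i j : Fin n) (h : i ≠ j) (c : k) (a : R) :
    slElem k i j h (c • a) = c • slElem k i j h a :=
  Subtype.ext (Matrix.smul_single c i j a).symm

theorem slElem_lie (i j l : Fin n) (hij : i ≠ j) (hjl : j ≠ l) (hil : i ≠ l) (a b : R) :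
    ⁅slElem k i j hij a, slElem k j l hjl b⁆ = slElem k i l hil (a * b) := by
  apply Subtype.ext
  rw [LieSubalgebra.coe_bracket, coe_slElem, coe_slElem, coe_slElem,
    LieRing.of_associative_ring_bracket, Matrix.single_mul_single_same,
    Matrix.single_mul_single_of_ne _ _ _ _ hil.symm, sub_zero]

theorem slElem_lie_eq_zero (i j l m : Fin n) (hij : i ≠ j) (hlm : l ≠ m) (hjl : j ≠ l)
    (him : i ≠ m) (a b : R) : ⁅slElem k i j hij a, slElem k l m hlm b⁆ = 0 := by
  apply Subtype.ext
  rw [LieSubalgebra.coe_bracket, coe_slElem, coe_slElem, LieRing.of_associative_ring_bracket,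
    Matrix.single_mul_single_of_ne _ _ _ _ hjl, Matrix.single_mul_single_of_ne _ _ _ _ him.symm,
    sub_zero]
  rfl

end ElementaryMatrices

/-! ### The presented Lie algebra -/

section PresentationLemmas

variable {k : Type uk} {R : Type uR} [CommRing k] [Ring R] [Algebra k R]

variable (k R) in
/-- The quotient map from the free Lie algebra, as a homomorphism of Lie algebras. -/
noncomputable def presMk : FreeLieAlgebra k (SlFourGen R) →ₗ⁅k⁆ SlFourPres k R :=
  { (LieSubmodule.Quotient.mk' (slFourRelIdeal k R)).toLinearMap with
    map_lie' := fun {_ _} => rfl }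

theorem presMk_freeX (i j : Fin 4) (h : i ≠ j) (s : R) :
    presMk k R (freeX k i j h s) = presX k i j h s := rfl

theorem presMk_surjective : Function.Surjective (presMk k R) :=
  LieSubmodule.Quotient.surjective_mk' (slFourRelIdeal k R)

theorem presMk_eq_of_rel {x y : FreeLieAlgebra k (SlFourGen R)} (h : SlFourRel k R x y) :
    presMk k R x = presMk k R y := by
  rw [← sub_eq_zero, ← map_sub]
  exact (LieSubmodule.Quotient.mk_eq_zero _).2 (LieSubmodule.subset_lieSpan ⟨x, y, h, rfl⟩)

/-- The universal property of the presented Lie algebra. -/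
theorem exists_presLift {L : Type*} [LieRing L] [LieAlgebra k L]
    (F : FreeLieAlgebra k (SlFourGen R) →ₗ⁅k⁆ L)
    (hF : ∀ x y, SlFourRel k R x y → F x = F y) :
    ∃ φ : SlFourPres k R →ₗ⁅k⁆ L, ∀ x, φ (presMk k R x) = F x := by
  have hle : slFourRelIdeal k R ≤ F.ker := by
    refine LieSubmodule.lieSpan_le.2 ?_
    rintro _ ⟨x, y, h, rfl⟩
    exact F.mem_ker.2 (by rw [map_sub, hF x y h, sub_self])
  have hle' : (slFourRelIdeal k R).toSubmodule ≤ LinearMap.ker (F : _ →ₗ[k] L) :=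
    fun x hx => F.mem_ker.1 (hle hx)
  let φ : SlFourPres k R →ₗ[k] L := (slFourRelIdeal k R).toSubmodule.liftQ (F : _ →ₗ[k] L) hle'
  have hφ : ∀ x, φ (presMk k R x) = F x := fun _ => rfl
  refine ⟨{ φ with map_lie' := ?_ }, hφ⟩
  intro x y
  obtain ⟨x, rfl⟩ := presMk_surjective x
  obtain ⟨y, rfl⟩ := presMk_surjective y
  change φ ⁅presMk k R x, presMk k R y⁆ = ⁅φ (presMk k R x), φ (presMk k R y)⁆
  rw [← LieHom.map_lie, hφ, hφ, hφ, LieHom.map_lie]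

theorem presHom_ext {L : Type*} [LieRing L] [LieAlgebra k L] {φ ψ : SlFourPres k R →ₗ⁅k⁆ L}
    (h : ∀ (i j : Fin 4) (hij : i ≠ j) (a : R), φ (presX k i j hij a) = ψ (presX k i j hij a)) :
    φ = ψ := by
  have key : φ.comp (presMk k R) = ψ.comp (presMk k R) :=
    FreeLieAlgebra.hom_ext fun x => h x.row x.col x.row_ne_col x.coeff
  ext x
  obtain ⟨x, rfl⟩ := presMk_surjective x
  exact LieHom.congr_fun key x

/-- The elements `X_ij(a)` generate the presented Lie algebra. -/
theorem mem_of_presX_mem (S : LieSubalgebra k (SlFourPres k R))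
    (h : ∀ (i j : Fin 4) (hij : i ≠ j) (a : R), presX k i j hij a ∈ S) (z : SlFourPres k R) :
    z ∈ S := by
  let F : FreeLieAlgebra k (SlFourGen R) →ₗ⁅k⁆ S :=
    FreeLieAlgebra.lift k fun x => ⟨presX k x.row x.col x.row_ne_col x.coeff, h _ _ _ _⟩
  have key : S.incl.comp F = presMk k R := by
    refine FreeLieAlgebra.hom_ext fun x => ?_
    rw [LieHom.comp_apply, FreeLieAlgebra.lift_of_apply]
    rfl
  obtain ⟨x, rfl⟩ := presMk_surjective z
  rw [← key]
  exact (F x).2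

/-- A linear subspace that contains the generators and is stable under bracketing with them is
everything. -/
theorem mem_of_presX_mem_of_lie_mem (S : Submodule k (SlFourPres k R))
    (h : ∀ (i j : Fin 4) (hij : i ≠ j) (a : R), presX k i j hij a ∈ S)
    (hlie : ∀ (i j : Fin 4) (hij : i ≠ j) (a : R), ∀ z ∈ S, ⁅presX k i j hij a, z⁆ ∈ S)
    (z : SlFourPres k R) : z ∈ S := by
  let N : LieSubalgebra k (SlFourPres k R) :=
    { carrier := {x | ∀ y ∈ S, ⁅x, y⁆ ∈ S}
      add_mem' := fun {x x'} hx hx' y hy => by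
        rw [add_lie]; exact S.add_mem (hx y hy) (hx' y hy)
      zero_mem' := fun y _ => by rw [zero_lie]; exact S.zero_mem
      smul_mem' := fun c x hx y hy => by rw [smul_lie]; exact S.smul_mem c (hx y hy)
      lie_mem' := fun {x x'} hx hx' y hy => by
        rw [lie_lie]; exact S.sub_mem (hx _ (hx' y hy)) (hx' _ (hx y hy)) }
  have hN : ∀ x, x ∈ N := mem_of_presX_mem N hlie
  exact mem_of_presX_mem { S with lie_mem' := fun {x y} _ hy => hN x y hy } h z

/-- An element that commutes with all generators is central. -/
theorem lie_eq_zero_of_presX_lie_eq_zero {z : SlFourPres k R}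
    (h : ∀ (i j : Fin 4) (hij : i ≠ j) (a : R), ⁅presX k i j hij a, z⁆ = 0)
    (x : SlFourPres k R) : ⁅x, z⁆ = 0 := by
  refine mem_of_presX_mem
    { carrier := {x | ⁅x, z⁆ = 0}
      add_mem' := fun {x x'} hx hx' => by
        change ⁅x + x', z⁆ = 0
        rw [add_lie, show ⁅x, z⁆ = 0 from hx, show ⁅x', z⁆ = 0 from hx', add_zero]
      zero_mem' := zero_lie z
      smul_mem' := fun c x hx => by
        change ⁅c • x, z⁆ = 0
        rw [smul_lie, show ⁅x, z⁆ = 0 from hx, smul_zero]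
      lie_mem' := fun {x x'} hx hx' => by
        change ⁅⁅x, x'⁆, z⁆ = 0
        rw [lie_lie, show ⁅x, z⁆ = 0 from hx, show ⁅x', z⁆ = 0 from hx', lie_zero, lie_zero,
          sub_zero] } h x

theorem presX_add (i j : Fin 4) (h : i ≠ j) (a b : R) :
    presX k i j h (a + b) = presX k i j h a + presX k i j h b :=
  presMk_eq_of_rel (SlFourRel.add i j h a b)

theorem presX_smul (i j : Fin 4) (h : i ≠ j) (c : k) (a : R) :
    presX k i j h (c • a) = c • presX k i j h a :=
  presMk_eq_of_rel (SlFourRel.smul i j h c a)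

variable (k) in
/-- The map `a ↦ X_ij(a)` as a linear map. -/
noncomputable def presXLinear (i j : Fin 4) (h : i ≠ j) : R →ₗ[k] SlFourPres k R where
  toFun := presX k i j h
  map_add' := presX_add i j h
  map_smul' := presX_smul i j h

theorem presX_zero (i j : Fin 4) (h : i ≠ j) : presX k i j h (0 : R) = 0 :=
  (presXLinear k i j h).map_zero

theorem presX_neg (i j : Fin 4) (h : i ≠ j) (a : R) : presX k i j h (-a) = -presX k i j h a :=
  (presXLinear k i j h).map_neg a

theorem presX_lie (i j l : Fin 4) (hij : i ≠ j) (hjl : j ≠ l) (hil : i ≠ l) (a b : R) :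
    ⁅presX k i j hij a, presX k j l hjl b⁆ = presX k i l hil (a * b) :=
  presMk_eq_of_rel (SlFourRel.steinberg i j l hij hjl hil a b)

theorem presX_lie_same_row (i j l : Fin 4) (hij : i ≠ j) (hil : i ≠ l) (a b : R) :
    ⁅presX k i j hij a, presX k i l hil b⁆ = 0 :=
  presMk_eq_of_rel (SlFourRel.same_row i j l hij hil a b)

theorem presX_lie_same_col (i j l : Fin 4) (hji : j ≠ i) (hli : l ≠ i) (a b : R) :
    ⁅presX k j i hji a, presX k l i hli b⁆ = 0 :=
  presMk_eq_of_rel (SlFourRel.same_col i j l hji hli a b)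

theorem lie_presX_lie_presX (i j l m : Fin 4) (hij : i ≠ j) (hlm : l ≠ m) (hil : i ≠ l)
    (him : i ≠ m) (hjl : j ≠ l) (hjm : j ≠ m) (a b : R) (w : SlFourPres k R) :
    ⁅w, ⁅presX k i j hij a, presX k l m hlm b⁆⁆ = 0 :=
  lie_eq_zero_of_presX_lie_eq_zero (fun p q hpq s =>
    presMk_eq_of_rel (SlFourRel.central i j l m hij hlm hil him hjl hjm a b p q hpq s)) w

theorem presX_lie_reverse (i j l : Fin 4) (hij : i ≠ j) (hli : l ≠ i) (hlj : l ≠ j) (a b : R) :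
    ⁅presX k i j hij a, presX k l i hli b⁆ = -presX k l j hlj (b * a) := by
  rw [← presX_lie l i j hli hij hlj, lie_skew]

end PresentationLemmas

/-! ### The toral part -/

section Weights

variable (k : Type uk) (R : Type uR) [CommRing k] [Ring R] [Algebra k R]

/-- The "toral" part of the presented Lie algebra: the elements `h` whose adjoint action
preserves each of the root spaces `X_ij(R)`. -/
noncomputable def presTorus : Submodule k (SlFourPres k R) where
  carrier := {h | ∀ (i j : Fin 4) (hij : i ≠ j) (a : R),
    ∃ b, ⁅h, presX k i j hij a⁆ = presX k i j hij b}
  add_mem' {h h'} H H' i j hij a := by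
    obtain ⟨b, hb⟩ := H i j hij a
    obtain ⟨c, hc⟩ := H' i j hij a
    exact ⟨b + c, by rw [add_lie, hb, hc, presX_add]⟩
  zero_mem' i j hij a := ⟨0, by rw [zero_lie, presX_zero]⟩
  smul_mem' c h H i j hij a := by
    obtain ⟨b, hb⟩ := H i j hij a
    exact ⟨c • b, by rw [smul_lie, hb, presX_smul]⟩

variable {k R}

theorem exists_ne_ne_ne (i j l : Fin 4) : ∃ m : Fin 4, m ≠ i ∧ m ≠ j ∧ m ≠ l := by
  revert i j l; decide

theorem mem_presTorus_of_central {z : SlFourPres k R} (hz : ∀ w : SlFourPres k R, ⁅w, z⁆ = 0) :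
    z ∈ presTorus k R :=
  fun i j hij a => ⟨0, by rw [← lie_skew z (presX k i j hij a), hz, presX_zero, neg_zero]⟩

theorem lie_lie_presX_row (i j l : Fin 4) (hij : i ≠ j) (hil : i ≠ l) (hjl : j ≠ l)
    (a b c : R) :
    ⁅⁅presX k i j hij a, presX k j i hij.symm b⁆, presX k i l hil c⁆ =
      presX k i l hil (a * (b * c)) := by
  rw [lie_lie, presX_lie j i l _ _ hjl, presX_lie i j l _ _ hil, presX_lie_same_row, lie_zero,
    sub_zero]

theorem lie_lie_presX_col (i j l : Fin 4) (hij : i ≠ j) (hli : l ≠ i) (hlj : l ≠ j)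
    (a b c : R) :
    ⁅⁅presX k i j hij a, presX k j i hij.symm b⁆, presX k l i hli c⁆ =
      presX k l i hli (-(c * a * b)) := by
  rw [lie_lie, presX_lie_same_col, lie_zero, zero_sub, presX_lie_reverse i j l _ _ hlj,
    lie_neg, neg_neg, presX_lie_reverse j i l _ _ hli, presX_neg]

theorem lie_lie_presX_disjoint (i j l m : Fin 4) (hij : i ≠ j) (hlm : l ≠ m) (hil : i ≠ l)
    (him : i ≠ m) (hjl : j ≠ l) (hjm : j ≠ m) (a b c : R) :
    ⁅⁅presX k i j hij a, presX k j i hij.symm b⁆, presX k l m hlm c⁆ = 0 := by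
  rw [lie_lie, lie_presX_lie_presX j i l m _ _ hjl hjm hil him,
    lie_presX_lie_presX i j l m _ _ hil him hjl hjm, sub_zero]

/-- Since `X_ij(c) = [X_im(c), X_mj(1)]`, an element preserving the root spaces of `(i, m)` and
`(m, j)` preserves that of `(i, j)`. -/
theorem exists_lie_presX_of_factor {h : SlFourPres k R} (i m j : Fin 4) (him : i ≠ m)
    (hmj : m ≠ j) (hij : i ≠ j) (c : R)
    (h₁ : ∃ b, ⁅h, presX k i m him c⁆ = presX k i m him b)
    (h₂ : ∃ b, ⁅h, presX k m j hmj (1 : R)⁆ = presX k m j hmj b) :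
    ∃ b, ⁅h, presX k i j hij c⁆ = presX k i j hij b := by
  obtain ⟨b₁, hb₁⟩ := h₁
  obtain ⟨b₂, hb₂⟩ := h₂
  refine ⟨b₁ * 1 + c * b₂, ?_⟩
  rw [← mul_one c, ← presX_lie i m j him hmj hij, leibniz_lie, hb₁, hb₂, presX_lie _ _ _ _ _ hij,
    presX_lie _ _ _ _ _ hij, presX_add, mul_one c]

/-- The bracket `[X_ij(a), X_ji(b)]` preserves the root spaces `X_lm(R)` with
`j ∉ {l, m}`. -/
theorem exists_lie_lie_presX (i j l m : Fin 4) (hij : i ≠ j) (hlm : l ≠ m) (hjl : j ≠ l)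
    (hjm : j ≠ m) (a b c : R) :
    ∃ d, ⁅⁅presX k i j hij a, presX k j i hij.symm b⁆, presX k l m hlm c⁆ =
      presX k l m hlm d := by
  by_cases hil : i = l
  · subst hil
    exact ⟨_, lie_lie_presX_row i j m hij hlm hjm a b c⟩
  by_cases him : i = m
  · subst him
    exact ⟨_, lie_lie_presX_col i j l hij hlm hjl.symm a b c⟩
  exact ⟨0, by rw [lie_lie_presX_disjoint i j l m hij hlm hil him hjl hjm, presX_zero]⟩

theorem exists_lie_lie_presX_swap (i j l m : Fin 4) (hij : i ≠ j) (hlm : l ≠ m) (hil : i ≠ l)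
    (him : i ≠ m) (a b c : R) :
    ∃ d, ⁅⁅presX k i j hij a, presX k j i hij.symm b⁆, presX k l m hlm c⁆ =
      presX k l m hlm d := by
  obtain ⟨d, hd⟩ := exists_lie_lie_presX (k := k) j i l m hij.symm hlm hil him b a c
  exact ⟨-d, by rw [← lie_skew (presX k i j hij a), neg_lie, hd, presX_neg]⟩

theorem lie_presX_presX_swap_mem (i j : Fin 4) (hij : i ≠ j) (a b : R) :
    ⁅presX k i j hij a, presX k j i hij.symm b⁆ ∈ presTorus k R := by
  intro l m hlm c
  by_cases h : j ≠ l ∧ j ≠ m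
  · exact exists_lie_lie_presX i j l m hij hlm h.1 h.2 a b c
  by_cases h' : i ≠ l ∧ i ≠ m
  · exact exists_lie_lie_presX_swap i j l m hij hlm h'.1 h'.2 a b c
  -- Here `{l, m} = {i, j}`; factor `X_lm(c)` through an index outside `{i, j}`.
  obtain ⟨p, hpi, hpj, -⟩ := exists_ne_ne_ne i j j
  have hlp : l ≠ p := by rintro rfl; grind
  have hpm : p ≠ m := by rintro rfl; grind
  refine exists_lie_presX_of_factor l p m hlp hpm hlm c ?_ ?_
  · by_cases hjl : j = l
    · exact exists_lie_lie_presX_swap i j l p hij hlp (hjl ▸ hij) hpi.symm a b c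
    · exact exists_lie_lie_presX i j l p hij hlp hjl hpj.symm a b c
  · by_cases hjm : j = m
    · exact exists_lie_lie_presX_swap i j p m hij hpm hpi.symm (hjm ▸ hij) a b 1
    · exact exists_lie_lie_presX i j p m hij hpm hpj.symm hjm a b 1

end Weights

/-! ### The projection to `sl_4(R)` and its kernel -/

section Projection

variable {k : Type uk} {R : Type uR} [CommRing k] [Ring R] [Algebra k R]

theorem exists_presToSl (k : Type uk) (R : Type uR) [CommRing k] [Ring R] [Algebra k R] :
    ∃ π : SlFourPres k R →ₗ⁅k⁆ slLie 4 k R,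
      ∀ (i j : Fin 4) (h : i ≠ j) (s : R), π (presX k i j h s) = slElem k i j h s := by
  let F : FreeLieAlgebra k (SlFourGen R) →ₗ⁅k⁆ slLie 4 k R :=
    FreeLieAlgebra.lift k fun x => slElem k x.row x.col x.row_ne_col x.coeff
  have hF : ∀ i j h (s : R), F (freeX k i j h s) = slElem k i j h s := fun i j h s =>
    FreeLieAlgebra.lift_of_apply ..
  obtain ⟨π, hπ⟩ := exists_presLift F (fun x y hxy => by
    induction hxy with
    | add i j hij a b => rw [map_add, hF, hF, hF, slElem_add]
    | smul i j hij c a => rw [map_smul, hF, hF, slElem_smul]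
    | steinberg i j l hij hjl hil a b => rw [LieHom.map_lie, hF, hF, hF, slElem_lie]
    | same i j hij a b =>
      rw [LieHom.map_lie, hF, hF, slElem_lie_eq_zero _ _ _ _ _ _ hij.symm hij, map_zero]
    | same_row i j l hij hil a b =>
      rw [LieHom.map_lie, hF, hF, slElem_lie_eq_zero _ _ _ _ _ _ hij.symm hil, map_zero]
    | same_col i j l hji hli a b =>
      rw [LieHom.map_lie, hF, hF, slElem_lie_eq_zero _ _ _ _ _ _ hli.symm hji, map_zero]
    | central i j l m hij hlm hil him hjl hjm a b p q hpq s =>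
      rw [LieHom.map_lie, LieHom.map_lie, hF i, hF l, slElem_lie_eq_zero _ _ _ _ _ _ hjl him,
        lie_zero, map_zero])
  exact ⟨π, fun i j h s => by rw [← presMk_freeX, hπ, hF]⟩

variable {π : SlFourPres k R →ₗ⁅k⁆ slLie 4 k R}

theorem surjective_of_presX
    (hπ : ∀ (i j : Fin 4) (h : i ≠ j) (s : R), π (presX k i j h s) = slElem k i j h s) :
    Function.Surjective π := by
  have hle : slLie 4 k R ≤ ((slLie 4 k R).incl.comp π).range := by
    refine LieSubalgebra.lieSpan_le.2 ?_
    rintro _ ⟨i, j, s, h, rfl⟩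
    exact ⟨presX k i j h s, congrArg Subtype.val (hπ i j h s)⟩
  rintro ⟨x, hx⟩
  obtain ⟨y, hy⟩ := hle hx
  exact ⟨y, Subtype.ext hy⟩

variable (k R) in
/-- The linear map `A ↦ ∑_{i ≠ j} X_ij(A_ij)`, a section of the projection to `sl_4(R)` on the
matrices with zero diagonal. -/
noncomputable def offDiagLift : Matrix (Fin 4) (Fin 4) R →ₗ[k] SlFourPres k R :=
  ∑ i, ∑ j, if h : i ≠ j then (presXLinear k i j h).comp (Matrix.entryLinearMap k R i j) else 0

theorem offDiagLift_apply (A : Matrix (Fin 4) (Fin 4) R) :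
    offDiagLift k R A = ∑ i, ∑ j, if h : i ≠ j then presX k i j h (A i j) else 0 := by
  simp only [offDiagLift, LinearMap.sum_apply]
  refine Finset.sum_congr rfl fun i _ => Finset.sum_congr rfl fun j _ => ?_
  split_ifs <;> rfl

theorem offDiagLift_single (i j : Fin 4) (hij : i ≠ j) (a : R) :
    offDiagLift k R (Matrix.single i j a) = presX k i j hij a := by
  rw [offDiagLift_apply, Finset.sum_eq_single i, Finset.sum_eq_single j]
  · rw [dif_pos hij, Matrix.single_apply_same]
  · intro m _ hm
    rw [Matrix.single_apply_of_col_ne _ _ hm.symm]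
    split_ifs
    exacts [presX_zero .., rfl]
  · simp
  · intro l _ hl
    refine Finset.sum_eq_zero fun m _ => ?_
    rw [Matrix.single_apply_of_row_ne hl.symm]
    split_ifs
    exacts [presX_zero .., rfl]
  · simp

theorem offDiagLift_eq_zero {A : Matrix (Fin 4) (Fin 4) R} (hA : ∀ i j, i ≠ j → A i j = 0) :
    offDiagLift k R A = 0 := by
  rw [offDiagLift_apply]
  refine Finset.sum_eq_zero fun i _ => Finset.sum_eq_zero fun j _ => ?_
  split_ifs with h
  · rw [hA i j h, presX_zero]
  · rfl

/-- Elements preserving all root spaces project to diagonal matrices. -/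
theorem apply_eq_zero_of_mem_presTorus
    (hπ : ∀ (i j : Fin 4) (h : i ≠ j) (s : R), π (presX k i j h s) = slElem k i j h s)
    {h : SlFourPres k R} (hh : h ∈ presTorus k R) (i j : Fin 4) (hij : i ≠ j) :
    (π h : Matrix (Fin 4) (Fin 4) R) i j = 0 := by
  -- Compare the `(i, m)` entries in `[π h, E_jm] = b E_jm`.
  obtain ⟨m, hmi, hmj, -⟩ := exists_ne_ne_ne i j j
  obtain ⟨b, hb⟩ := hh j m hmj.symm 1
  have key := congrArg (fun x => (π x : Matrix (Fin 4) (Fin 4) R) i m) hb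
  simpa [hπ, coe_slElem, LieRing.of_associative_ring_bracket, hij.symm, hij] using key

/-- The decomposition of the presented Lie algebra into root spaces and toral part: each element
is, modulo the toral part, the sum of the `X_ij` of the off-diagonal entries of its image. -/
theorem sub_offDiagLift_mem_presTorus
    (hπ : ∀ (i j : Fin 4) (h : i ≠ j) (s : R), π (presX k i j h s) = slElem k i j h s)
    (z : SlFourPres k R) :
    z - offDiagLift k R (π z : Matrix (Fin 4) (Fin 4) R) ∈ presTorus k R := by
  let D : SlFourPres k R →ₗ[k] SlFourPres k R :=
    LinearMap.id - (offDiagLift k R).comp (((slLie 4 k R).incl.comp π : _ →ₗ⁅k⁆ _) : _ →ₗ[k] _)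
  let S := (presTorus k R).comap D
  have hD : ∀ z, D z = z - offDiagLift k R (π z : Matrix (Fin 4) (Fin 4) R) := fun _ => rfl
  have hX : ∀ (i j : Fin 4) (hij : i ≠ j) (a : R), presX k i j hij a ∈ S := fun i j hij a => by
    rw [Submodule.mem_comap, hD, hπ, coe_slElem, offDiagLift_single _ _ hij, sub_self]
    exact zero_mem _
  have hT : ∀ h ∈ presTorus k R, h ∈ S := fun h hh => by
    rw [Submodule.mem_comap, hD, offDiagLift_eq_zero (apply_eq_zero_of_mem_presTorus hπ hh),
      sub_zero]
    exact hh
  have hXX : ∀ (i j : Fin 4) (hij : i ≠ j) (a : R) (l m : Fin 4) (hlm : l ≠ m) (b : R),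
      ⁅presX k i j hij a, presX k l m hlm b⁆ ∈ S := by
    intro i j hij a l m hlm b
    by_cases hjl : j = l
    · subst hjl
      by_cases him : i = m
      · subst him
        exact hT _ (lie_presX_presX_swap_mem i j hij a b)
      · rw [presX_lie i j m hij hlm him]
        exact hX _ _ _ _
    by_cases him : i = m
    · subst him
      rw [presX_lie_reverse i j l hij hlm (Ne.symm hjl)]
      exact S.neg_mem (hX _ _ _ _)
    by_cases hil : i = l
    · subst hil
      rw [presX_lie_same_row]
      exact zero_mem _
    by_cases hjm : j = m
    · subst hjm
      rw [presX_lie_same_col]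
      exact zero_mem _
    exact hT _ (mem_presTorus_of_central
      (lie_presX_lie_presX i j l m hij hlm hil him hjl hjm a b))
  refine mem_of_presX_mem_of_lie_mem S hX (fun i j hij a z hz => ?_) z
  have hz' : z = offDiagLift k R (π z : Matrix (Fin 4) (Fin 4) R) + D z := by rw [hD]; abel
  rw [hz', lie_add]
  refine S.add_mem ?_ ?_
  · rw [offDiagLift_apply, lie_sum]
    refine S.sum_mem fun l _ => ?_
    rw [lie_sum]
    refine S.sum_mem fun m _ => ?_
    split_ifs with hlm
    · exact hXX _ _ _ _ _ _ _ _
    · rw [lie_zero]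
      exact zero_mem _
  · obtain ⟨b, hb⟩ := hz i j hij a
    rw [← lie_skew, hb]
    exact S.neg_mem (hX _ _ _ _)

theorem isCentralExtension_of_presX
    (hπ : ∀ (i j : Fin 4) (h : i ≠ j) (s : R), π (presX k i j h s) = slElem k i j h s) :
    IsCentralExtension π where
  surjective := surjective_of_presX hπ
  ker_le_center z hz := by
    rw [LieHom.mem_ker] at hz
    have hT : z ∈ presTorus k R := by
      have := sub_offDiagLift_mem_presTorus hπ z
      rwa [hz, ZeroMemClass.coe_zero, map_zero, sub_zero] at this
    refine (LieModule.mem_maxTrivSubmodule k _ _ z).2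
      (lie_eq_zero_of_presX_lie_eq_zero fun i j hij a => ?_)
    obtain ⟨b, hb⟩ := hT i j hij a
    have hb0 : b = 0 := by
      have h := congrArg π hb
      rw [LieHom.map_lie, hz, zero_lie, hπ] at h
      have h' := congrArg (fun x : slLie 4 k R => (x : Matrix (Fin 4) (Fin 4) R) i j) h
      simpa [coe_slElem] using h'.symm
    rw [← lie_skew, hb, hb0, presX_zero, neg_zero]

end Projection

/-! ### Homomorphisms to central extensions -/

section Universality

variable {k : Type uk} {R : Type uR} [CommRing k] [Ring R] [Algebra k R]
  {M : Type*} [LieRing M] [LieAlgebra k M] {f : M →ₗ⁅k⁆ slLie 4 k R}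

namespace IsCentralExtension

/-- Moving the middle index: `[E_ij(a), E_jl(b)]~ = [E_im(ab), E_ml(1)]~` for lifts along a
central extension and four distinct indices. -/
theorem lie_eq_of_ne (hf : IsCentralExtension f) {i j l m : Fin 4} (hij : i ≠ j) (hjl : j ≠ l)
    (him : i ≠ m) (hml : m ≠ l) (hjm : j ≠ m) (hil : i ≠ l) (a b : R) {u v u' v' : M}
    (hu : f u = slElem k i j hij a) (hv : f v = slElem k j l hjl b)
    (hu' : f u' = slElem k i m him (a * b)) (hv' : f v' = slElem k m l hml 1) :
    ⁅u, v⁆ = ⁅u', v'⁆ := by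
  -- Replace `v` by `[w, v']` with `w` over `E_jm(b)`, and expand by the Jacobi identity.
  obtain ⟨w, hw⟩ := hf.surjective (slElem k j m hjm b)
  have h1 : ⁅u, v⁆ = ⁅u, ⁅w, v'⁆⁆ :=
    hf.lie_congr rfl (by rw [LieHom.map_lie, hw, hv, hv', slElem_lie _ _ _ _ _ hjl, mul_one])
  have h2 : ⁅⁅u, w⁆, v'⁆ = ⁅u', v'⁆ :=
    hf.lie_congr (by rw [LieHom.map_lie, hu, hw, hu', slElem_lie _ _ _ _ _ him]) rfl
  have h3 : ⁅w, ⁅u, v'⁆⁆ = 0 :=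
    hf.lie_eq_zero (by rw [LieHom.map_lie, hu, hv', slElem_lie_eq_zero _ _ _ _ _ _ hjm hil]) w
  rw [h1, leibniz_lie, h2, h3, add_zero]

/-- The bracket of lifts of `E_ij(a)` and `E_jl(b)` depends only on `i`, `l` and `a * b`. -/
theorem lie_eq (hf : IsCentralExtension f) {i j l m : Fin 4} (hij : i ≠ j) (hjl : j ≠ l)
    (him : i ≠ m) (hml : m ≠ l) (hil : i ≠ l) (a b : R) {u v u' v' : M}
    (hu : f u = slElem k i j hij a) (hv : f v = slElem k j l hjl b)
    (hu' : f u' = slElem k i m him (a * b)) (hv' : f v' = slElem k m l hml 1) :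
    ⁅u, v⁆ = ⁅u', v'⁆ := by
  by_cases hjm : j = m
  · subst hjm
    -- Pass through a fourth index.
    obtain ⟨p, hpi, hpj, hpl⟩ := exists_ne_ne_ne i j l
    obtain ⟨x, hx⟩ := hf.surjective (slElem k i p hpi.symm (a * b))
    obtain ⟨y, hy⟩ := hf.surjective (slElem k p l hpl (1 : R))
    rw [hf.lie_eq_of_ne hij hjl hpi.symm hpl hpj.symm hil a b hu hv hx hy]
    exact (hf.lie_eq_of_ne hij hjl hpi.symm hpl hpj.symm hil (a * b) 1 hu' hv'
      (by rw [hx, mul_one]) hy).symm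
  · exact hf.lie_eq_of_ne hij hjl him hml hjm hil a b hu hv hu' hv'

/-- Lifts of `E_ij(a)` and `E_il(b)` commute; `l = j` is allowed. -/
theorem lie_eq_zero_of_row (hf : IsCentralExtension f) {i j l : Fin 4} (hij : i ≠ j)
    (hil : i ≠ l) (a b : R) {u v : M} (hu : f u = slElem k i j hij a)
    (hv : f v = slElem k i l hil b) : ⁅u, v⁆ = 0 := by
  obtain ⟨m, hmi, hmj, hml⟩ := exists_ne_ne_ne i j l
  obtain ⟨x, hx⟩ := hf.surjective (slElem k i m hmi.symm b)
  obtain ⟨y, hy⟩ := hf.surjective (slElem k m l hml (1 : R))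
  have h1 : ⁅u, v⁆ = ⁅u, ⁅x, y⁆⁆ :=
    hf.lie_congr rfl (by rw [LieHom.map_lie, hx, hv, hy, slElem_lie _ _ _ _ _ hil, mul_one])
  have h2 : ⁅⁅u, x⁆, y⁆ = 0 := hf.lie_eq_zero'
    (by rw [LieHom.map_lie, hu, hx, slElem_lie_eq_zero _ _ _ _ _ _ hij.symm hmi.symm]) y
  have h3 : ⁅x, ⁅u, y⁆⁆ = 0 := hf.lie_eq_zero
    (by rw [LieHom.map_lie, hu, hy, slElem_lie_eq_zero _ _ _ _ _ _ hmj.symm hil]) x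
  rw [h1, leibniz_lie, h2, h3, add_zero]

/-- Lifts of `E_ji(a)` and `E_li(b)` commute; `l = j` is allowed. -/
theorem lie_eq_zero_of_col (hf : IsCentralExtension f) {i j l : Fin 4} (hji : j ≠ i)
    (hli : l ≠ i) (a b : R) {u v : M} (hu : f u = slElem k j i hji a)
    (hv : f v = slElem k l i hli b) : ⁅u, v⁆ = 0 := by
  obtain ⟨m, hmi, hmj, hml⟩ := exists_ne_ne_ne i j l
  obtain ⟨x, hx⟩ := hf.surjective (slElem k l m hml.symm b)
  obtain ⟨y, hy⟩ := hf.surjective (slElem k m i hmi (1 : R))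
  have h1 : ⁅u, v⁆ = ⁅u, ⁅x, y⁆⁆ :=
    hf.lie_congr rfl (by rw [LieHom.map_lie, hx, hv, hy, slElem_lie _ _ _ _ _ hli, mul_one])
  have h2 : ⁅⁅u, x⁆, y⁆ = 0 := hf.lie_eq_zero'
    (by rw [LieHom.map_lie, hu, hx, slElem_lie_eq_zero _ _ _ _ _ _ hli.symm hmj.symm]) y
  have h3 : ⁅x, ⁅u, y⁆⁆ = 0 := hf.lie_eq_zero
    (by rw [LieHom.map_lie, hu, hy, slElem_lie_eq_zero _ _ _ _ _ _ hmi.symm hji]) x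
  rw [h1, leibniz_lie, h2, h3, add_zero]

/-- The canonical lifts of the `E_il(a)` along a central extension: the brackets of arbitrary
lifts of `E_ij(a)` and `E_jl(b)` with `a b = c` all coincide. -/
theorem exists_steinberg_lift (hf : IsCentralExtension f) :
    ∃ Y : ∀ i l : Fin 4, i ≠ l → R → M,
      (∀ i l hil a, f (Y i l hil a) = slElem k i l hil a) ∧
      ∀ (i j l : Fin 4) (hij : i ≠ j) (hjl : j ≠ l) (hil : i ≠ l) (a b : R) (u v : M),
        f u = slElem k i j hij a → f v = slElem k j l hjl b → ⁅u, v⁆ = Y i l hil (a * b) := by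
  choose s hs using hf.surjective
  choose m hmi hml _ using exists_ne_ne_ne
  refine ⟨fun i l _ a => ⁅s (slElem k i (m i l l) (hmi i l l).symm a),
    s (slElem k (m i l l) l (hml i l l) 1)⁆, fun i l hil a => ?_, ?_⟩
  · rw [LieHom.map_lie, hs, hs, slElem_lie _ _ _ _ _ hil, mul_one]
  · intro i j l hij hjl hil a b u v hu hv
    exact hf.lie_eq hij hjl _ _ hil a b hu hv (hs _) (hs _)

/-- Every central extension of `sl_4(R)` receives a homomorphism from the presented Lie algebra
over `sl_4(R)`. -/
theorem exists_lift (hf : IsCentralExtension f) {π : SlFourPres k R →ₗ⁅k⁆ slLie 4 k R}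
    (hπ : ∀ (i j : Fin 4) (h : i ≠ j) (s : R), π (presX k i j h s) = slElem k i j h s) :
    ∃ φ : SlFourPres k R →ₗ⁅k⁆ M, f.comp φ = π := by
  obtain ⟨Y, hY, hYY⟩ := hf.exists_steinberg_lift
  let F : FreeLieAlgebra k (SlFourGen R) →ₗ⁅k⁆ M :=
    FreeLieAlgebra.lift k fun x => Y x.row x.col x.row_ne_col x.coeff
  have hF : ∀ i j h (s : R), F (freeX k i j h s) = Y i j h s := fun i j h s =>
    FreeLieAlgebra.lift_of_apply ..
  obtain ⟨φ, hφ⟩ := exists_presLift F (fun x y hxy => by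
    induction hxy with
    | add i j hij a b =>
      obtain ⟨m, hmi, hmj, -⟩ := exists_ne_ne_ne i j j
      have key : ∀ c, Y i j hij c = ⁅Y i m hmi.symm c, Y m j hmj 1⁆ := fun c => by
        rw [hYY i m j _ _ hij c 1 _ _ (hY ..) (hY ..), mul_one]
      rw [map_add, hF, hF, hF, key a, key b, ← add_lie, ← mul_one (a + b)]
      exact (hYY i m j hmi.symm hmj hij (a + b) 1 _ _
        (by rw [map_add, hY, hY, slElem_add]) (hY ..)).symm
    | smul i j hij c a =>
      obtain ⟨m, hmi, hmj, -⟩ := exists_ne_ne_ne i j j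
      have key : Y i j hij a = ⁅Y i m hmi.symm a, Y m j hmj 1⁆ := by
        rw [hYY i m j _ _ hij a 1 _ _ (hY ..) (hY ..), mul_one]
      rw [map_smul, hF, hF, key, ← smul_lie, ← mul_one (c • a)]
      exact (hYY i m j hmi.symm hmj hij (c • a) 1 _ _
        (by rw [map_smul, hY, slElem_smul]) (hY ..)).symm
    | steinberg i j l hij hjl hil a b =>
      rw [LieHom.map_lie, hF, hF, hF]
      exact hYY i j l hij hjl hil a b _ _ (hY ..) (hY ..)
    | same i j hij a b =>
      rw [LieHom.map_lie, hF, hF, map_zero]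
      exact hf.lie_eq_zero_of_row hij hij a b (hY ..) (hY ..)
    | same_row i j l hij hil a b =>
      rw [LieHom.map_lie, hF, hF, map_zero]
      exact hf.lie_eq_zero_of_row hij hil a b (hY ..) (hY ..)
    | same_col i j l hji hli a b =>
      rw [LieHom.map_lie, hF, hF, map_zero]
      exact hf.lie_eq_zero_of_col hji hli a b (hY ..) (hY ..)
    | central i j l m hij hlm hil him hjl hjm a b p q hpq s =>
      rw [LieHom.map_lie, LieHom.map_lie, hF i, hF l, map_zero]
      exact hf.lie_eq_zero
        (by rw [LieHom.map_lie, hY, hY, slElem_lie_eq_zero _ _ _ _ _ _ hjl him]) _)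
  refine ⟨φ, presHom_ext fun i j hij a => ?_⟩
  rw [LieHom.comp_apply, ← presMk_freeX, hφ, hF, hY, presMk_freeX, hπ]

/-- The presented Lie algebra is perfect, so two homomorphisms from it that agree modulo a
central kernel are equal. -/
theorem lift_unique (hf : IsCentralExtension f) {φ ψ : SlFourPres k R →ₗ⁅k⁆ M}
    (h : f.comp φ = f.comp ψ) : φ = ψ := by
  refine presHom_ext fun i j hij a => ?_
  obtain ⟨m, hmi, hmj, -⟩ := exists_ne_ne_ne i j j
  rw [← mul_one a, ← presX_lie i m j hmi.symm hmj hij, LieHom.map_lie, LieHom.map_lie]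
  exact hf.lie_congr (LieHom.congr_fun h _) (LieHom.congr_fun h _)

end IsCentralExtension

theorem isUniversalCentralExtension_of_presX {π : SlFourPres k R →ₗ⁅k⁆ slLie 4 k R}
    (hπ : ∀ (i j : Fin 4) (h : i ≠ j) (s : R), π (presX k i j h s) = slElem k i j h s) :
    IsUniversalCentralExtension.{w} π where
  isCentralExtension := isCentralExtension_of_presX hπ
  existsUnique_lift M _ _ f hf := by
    obtain ⟨φ, hφ⟩ := hf.exists_lift hπ
    exact ⟨φ, hφ, fun ψ hψ => hf.lift_unique (hψ.trans hφ.symm)⟩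

end Universality

/-! ### The universal central extension -/

theorem lemma3p4 (k : Type uk) (R : Type uR) [CommRing k] [Ring R] [Algebra k R]
    [Module.Free k R] :
    ∃ π : SlFourPres k R →ₗ⁅k⁆ slLie 4 k R,
      (∀ (i j : Fin 4) (h : i ≠ j) (s : R),
        (π (presX k i j h s) : Matrix (Fin 4) (Fin 4) R) = Matrix.single i j s) ∧
      IsUniversalCentralExtension.{w} π ∧
      ∀ (L : Type (max uk uR w)) [LieRing L] [LieAlgebra k L] (u : L →ₗ⁅k⁆ slLie 4 k R),
        IsUniversalCentralExtension.{max uk uR w} u →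
          ∃ e : SlFourPres k R ≃ₗ⁅k⁆ L, ∀ x, u (e x) = π x := by
  obtain ⟨π, hπ⟩ := exists_presToSl k R
  refine ⟨π, fun i j h s => by rw [hπ, coe_slElem], isUniversalCentralExtension_of_presX hπ, ?_⟩
  intro L _ _ u hu
  have hc := isCentralExtension_of_presX hπ
  have hcu := hu.isCentralExtension
  obtain ⟨ψ, hψ⟩ := hcu.exists_lift hπ
  -- The presented algebra lives in a smaller universe than `L`, so `u` is lifted through `ULift`.
  obtain ⟨φ', hφ', -⟩ :=
    hu.existsUnique_lift (ULift.{max uk uR w} (SlFourPres k R)) _ hc.comp_down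
  let φ : L →ₗ⁅k⁆ SlFourPres k R := (ULift.downLieHom k _).comp φ'
  have hφ : π.comp φ = u := hφ'
  have h1 : φ.comp ψ = LieHom.id := hc.lift_unique (by
    change (π.comp φ).comp ψ = π
    rw [hφ, hψ])
  have h2 : ψ.comp φ = LieHom.id := by
    refine (hu.existsUnique_lift L u hcu).unique ?_ rfl
    change (u.comp ψ).comp φ = u
    rw [hψ, hφ]
  refine ⟨{ ψ with
    invFun := φ
    left_inv := LieHom.congr_fun h1
    right_inv := LieHom.congr_fun h2 }, LieHom.congr_fun hψ⟩
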